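/- Let $M=(a_{i,j})_{0\le i,j\le n}$ be the Cartan matrix of an irreducible affine Weyl group, untwisted or twisted: an indecomposable generalized Cartan matrix with integer entries ($a_{i,i}=2$; $a_{i,j}\le 0$ for $i\neq j$; $a_{i,j}=0$ implies $a_{j,i}=0$), together with the positive coprime integers $a_0,\dots,a_n$ such that $\sum_j a_{i,j}a_j=0$ for all $i$. Let $V=\bigoplus_{i=0}^n\mathbb{R}\Lambda^\vee_i$ be the coweight space, with the simple roots $\alpha_0,\dots,\alpha_n$ as dual basis, simple coroots $\alpha^\vee_i=\sum_j a_{i,j}\Lambda^\vee_j$ and simple reflections $s_i(x)=x-\langle x,\alpha_i\rangle\alpha_i^\vee$. The affine Weyl group is $W=\langle s_0,\dots,s_n\rangle\subset GL(V)$. It stabilizes the level $0$ hyperplane $V^0=\{x\in V : \langle x,\sum_i a_i\alpha_i\rangle=0\}$. Let $\mathrm{cl}:W\to GL(V^0)$ be the restriction map and let $\mathring W=\mathrm{cl}(W)$ be the finite Weyl group. Assume, as usual, that the Dynkin diagram is labelled so that $\mathring W=\langle\mathrm{cl}(s_1),\dots,\mathrm{cl}(s_n)\rangle$. Call $\mathring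 C=\{x\in V^0 : \langle x,\alpha_i\rangle>0 \text{ for } i=1,\dots,n\}$ the fundamental chamber of $\mathring W$ and the sets $w(\mathring C)$, $w\in\mathring W$, its chambers. Let $\mathring\rho^\vee\in V^0$ be half the sum of the positive coroots of $\mathring W$, that is, of those elements $w(\alpha_i^\vee)$ with $w\in\mathring W$ and $1\le i\le n$ that are nonnegative combinations of $\alpha_1^\vee,\dots,\alpha_n^\vee$. For $i=0,\dots,n$, the generator $\pi_i$ of the $0$-Hecke algebra of $W$ acts at level $0$ * on $\mathring W$, from the right, by $w.\pi_i=w\,\mathrm{cl}(s_i)$ if $\langle w^{-1}(\mathring\rho^\vee),\alpha_i\rangle>0$, and $w.\pi_i=w$ otherwise; * on the chambers of $\mathring W$, by taking images under the map $\pi_i:V^0\to V^0$ with $\pi_i(x)=s_i(x)$ if $\langle x,\alpha_i\rangle>0$, and $\pi_i(x)=x$ otherwise. **Theorem.** The action of $\pi_0,\dots,\pi_n$ on $\mathring W$ is transitive: for all $w,w'\in\mathring W$ there is a word $i_1,\dots,i_r$ in $\{0,\dots,n\}$ such that $w.\pi_{i_1}\cdots\pi_{i_r}=w'$. Equivalently,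 the action on the chambers is transitive: the map $w\mapsto w^{-1}(\mathring C)$ is a bijection from $\mathring W$ to the set of chambers, it satisfies $\pi_i(w^{-1}(\mathring C))=(w.\pi_i)^{-1}(\mathring C)$ for all $w$ and $i$, and for all chambers $E,E'$ there is a word $i_1,\dots,i_r$ such that $\pi_{i_r}(\cdots\pi_{i_1}(E)\cdots)=E'$. -/

import Mathlib

namespace AffineWeyl

/-- An affine Cartan matrix (untwisted or twisted) with rows and columns indexed by `0, …, n`:
an indecomposable generalized Cartan matrix with a strictly positive integer vector of relations
`∑ j, a j * M i j = 0` between its columns. That vector, normalized to have coprime entries, is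
uniquely determined by `M`; its entries `a j` are the canonical marks. -/
structure AffineCartanMatrix (n : ℕ) where
  /-- The matrix `M i j = ⟨αᵢ^∨, αⱼ⟩`. -/
  M : Matrix (Fin (n + 1)) (Fin (n + 1)) ℤ
  diag : ∀ i, M i i = 2
  offDiag_nonpos : ∀ i j, i ≠ j → M i j ≤ 0
  zero_symm : ∀ i j, M i j = 0 → M j i = 0
  indecomposable : ∀ S : Set (Fin (n + 1)), S.Nonempty → Sᶜ.Nonempty →
    ∃ i ∈ S, ∃ j ∈ Sᶜ, M i j ≠ 0
  /-- The canonical marks `a j`. -/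
  a : Fin (n + 1) → ℕ
  a_pos : ∀ j, 0 < a j
  a_coprime : Finset.univ.gcd a = 1
  a_null : ∀ i, ∑ j, M i j * (a j : ℤ) = 0

/-- The real coweight space, in coordinates with respect to the basis of fundamental coweights. -/
abbrev Coweight (n : ℕ) : Type := Fin (n + 1) → ℝ

/-- The simple root `α i`, as the linear form `x ↦ ⟨x, α i⟩` on the coweight space. -/
def simpleRoot {n : ℕ} (i : Fin (n + 1)) : Coweight n →ₗ[ℝ] ℝ := LinearMap.proj i

namespace AffineCartanMatrix

variable {n : ℕ} (D : AffineCartanMatrix n)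

/-- The simple coroot `αᵢ^∨ = ∑ j, M i j • Λⱼ^∨`. -/
def simpleCoroot (i : Fin (n + 1)) : Coweight n := fun j => (D.M i j : ℝ)

theorem simpleRoot_simpleCoroot (i : Fin (n + 1)) :
    simpleRoot i (D.simpleCoroot i) = 2 := by
  simp [simpleRoot, simpleCoroot, D.diag i]

/-- The simple reflection `s i : x ↦ x - ⟨x, α i⟩ • αᵢ^∨`. -/
noncomputable def s (i : Fin (n + 1)) : Coweight n ≃ₗ[ℝ] Coweight n :=
  Module.reflection (D.simpleRoot_simpleCoroot i)

/-- The affine Weyl group, generated by the simple reflections of the coweight space. -/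
def affineWeylGroup : Subgroup (Coweight n ≃ₗ[ℝ] Coweight n) :=
  Subgroup.closure (Set.range D.s)

/-- The level `x ↦ ⟨x, δ⟩`, where `δ = ∑ i, a i • α i` is the null root. -/
noncomputable def level : Coweight n →ₗ[ℝ] ℝ := ∑ i, (D.a i : ℝ) • simpleRoot i

/-- The hyperplane of coweights of level `0`. -/
noncomputable def levelZero : Submodule ℝ (Coweight n) := LinearMap.ker D.level

theorem mem_levelZero {x : Coweight n} : x ∈ D.levelZero ↔ D.level x = 0 := LinearMap.mem_ker

theorem level_simpleCoroot (i : Fin (n + 1)) : D.level (D.simpleCoroot i) = 0 := by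
  have h := congrArg (fun z : ℤ => (z : ℝ)) (D.a_null i)
  simp only [Int.cast_sum, Int.cast_mul, Int.cast_natCast, Int.cast_zero] at h
  simpa [level, simpleRoot, simpleCoroot, LinearMap.sum_apply, mul_comm] using h

theorem level_s (i : Fin (n + 1)) (x : Coweight n) : D.level (D.s i x) = D.level x := by
  simp [s, Module.reflection_apply, level_simpleCoroot]

theorem level_eq_of_mem {w : Coweight n ≃ₗ[ℝ] Coweight n} (hw : w ∈ D.affineWeylGroup) :
    ∀ x, D.level (w x) = D.level x := by
  induction hw using Subgroup.closure_induction with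
  | mem w hw =>
    obtain ⟨i, rfl⟩ := hw
    exact D.level_s i
  | one => intro x; rfl
  | mul u v _ _ hu hv => intro x; rw [LinearEquiv.mul_apply, hu, hv]
  | inv u _ hu =>
    intro x
    have h := hu (u⁻¹ x)
    rw [← LinearEquiv.mul_apply, mul_inv_cancel] at h
    exact h.symm

/-- The level `0` action `cl` of the affine Weyl group: restriction to the level `0` hyperplane. -/
noncomputable def cl : D.affineWeylGroup →* (D.levelZero ≃ₗ[ℝ] D.levelZero) where
  toFun w :=
    { toFun := fun x => ⟨w.1 x.1, by
        rw [D.mem_levelZero, D.level_eq_of_mem w.2, D.mem_levelZero.1 x.2]⟩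
      invFun := fun x => ⟨w.1⁻¹ x.1, by
        rw [D.mem_levelZero, D.level_eq_of_mem (inv_mem w.2), D.mem_levelZero.1 x.2]⟩
      map_add' := fun x y => Subtype.ext (by simp)
      map_smul' := fun c x => Subtype.ext (by simp)
      left_inv := fun x => Subtype.ext (w.1.symm_apply_apply x.1)
      right_inv := fun x => Subtype.ext (w.1.apply_symm_apply x.1) }
  map_one' := rfl
  map_mul' _ _ := rfl

/-- The finite Weyl group: the image of the affine Weyl group under `cl`. -/
noncomputable def finiteWeylGroup : Subgroup (D.levelZero ≃ₗ[ℝ] D.levelZero) := D.cl.range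

/-- `cl (s i)`, as an element of the finite Weyl group. -/
noncomputable def sBar (i : Fin (n + 1)) : D.finiteWeylGroup :=
  D.cl.rangeRestrict ⟨D.s i, Subgroup.subset_closure ⟨i, rfl⟩⟩

/-- The labelling of the Dynkin diagram is appropriate: `cl (s 1), …, cl (s n)` generate the
finite Weyl group. -/
def AppropriatelyLabelled : Prop :=
  Subgroup.closure (Set.range fun i : Fin n => D.sBar i.succ) = ⊤

/-- The simple coroot `αᵢ^∨`, as an element of the level `0` hyperplane. -/
noncomputable def simpleCorootZero (i : Fin (n + 1)) : D.levelZero :=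
  ⟨D.simpleCoroot i, D.level_simpleCoroot i⟩

/-- The coroots of the finite Weyl group: the images of `α₁^∨, …, αₙ^∨` under the group. -/
def finiteCoroots : Set D.levelZero :=
  {β | ∃ (w : D.finiteWeylGroup) (i : Fin n), β = w.1 (D.simpleCorootZero i.succ)}

/-- The positive coroots of the finite Weyl group: those that are nonnegative combinations of
`α₁^∨, …, αₙ^∨`. -/
def positiveFiniteCoroots : Set D.levelZero :=
  {β | β ∈ D.finiteCoroots ∧
    ∃ c : Fin n → ℝ, (∀ i, 0 ≤ c i) ∧ β = ∑ i, c i • D.simpleCorootZero i.succ}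

/-- The half-sum of the positive coroots of the finite Weyl group. -/
noncomputable def rhoCheck : D.levelZero :=
  (1 / 2 : ℝ) • ∑ᶠ β ∈ D.positiveFiniteCoroots, β

/-- The right action of the `0`-Hecke generator `π i` on the finite Weyl group at level `0`:
`w.(π i) = w * cl (s i)` if `⟨w⁻¹ ρ^∨, α i⟩ > 0`, and `w.(π i) = w` otherwise. -/
noncomputable def piGroup (w : D.finiteWeylGroup) (i : Fin (n + 1)) : D.finiteWeylGroup :=
  open Classical in
  if 0 < simpleRoot i (((w⁻¹).1 D.rhoCheck : D.levelZero) : Coweight n) then w * D.sBar i else w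

/-- The half-linear idempotent `π i` of the coweight space, which projects it onto the nonpositive
half space of `α i`: `π i x = s i x` if `⟨x, α i⟩ > 0`, and `π i x = x` otherwise. -/
noncomputable def piOp (i : Fin (n + 1)) (x : Coweight n) : Coweight n :=
  open Classical in if 0 < simpleRoot i x then D.s i x else x

theorem level_piOp (i : Fin (n + 1)) (x : Coweight n) : D.level (D.piOp i x) = D.level x := by
  unfold piOp
  split_ifs
  · exact D.level_s i x
  · rfl

/-- The operator `π i` at level `0`. -/
noncomputable def piZero (i : Fin (n + 1)) (x : D.levelZero) : D.levelZero :=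
  ⟨D.piOp i x.1, by
    rw [D.mem_levelZero, D.level_piOp, D.mem_levelZero.1 x.2]⟩

/-- The fundamental chamber of the finite Weyl group. -/
def fundamentalChamber : Set D.levelZero :=
  {x | ∀ i : Fin n, 0 < simpleRoot i.succ (x : Coweight n)}

/-- The chambers of the finite Weyl group: the images of the fundamental chamber. -/
def chambers : Set (Set D.levelZero) :=
  Set.range fun w : D.finiteWeylGroup => w.1 '' D.fundamentalChamber

/-- The chamber that represents `w` when the finite Weyl group is acted on from the right: the one
that contains `w⁻¹ ρ^∨`. -/
def chamberOf (w : D.finiteWeylGroup) : Set D.levelZero :=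
  (w⁻¹).1 '' D.fundamentalChamber

/-- The action of `π i` on sets of coweights of level `0`, in particular on chambers. -/
def piChamber (E : Set D.levelZero) (i : Fin (n + 1)) : Set D.levelZero :=
  D.piZero i '' E

end AffineCartanMatrix

end AffineWeyl

/-!
The action on the finite Weyl group `W̊` is transitive because it carries a circulation. Put `x = w⁻¹ ρ^∨`. On the graph
with an arrow from `w` to `w * cl (s i)` whenever `⟨x, α i⟩ > 0`, give this arrow the weight
`a i * ⟨x, α i⟩`. As `cl (s i)` is a reflection, the arrows into `w` have the weights
`-a i * ⟨x, α i⟩` for those `i` with `⟨x, α i⟩ < 0`, so that at every `w` the outflow minus the inflow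
is `∑ i, a i * ⟨x, α i⟩`, the level of `x`, which is `0`. In a finite graph with a positive circulation
no arrow enters a set that no arrow leaves. So the set of elements that can be reached from `w` is
closed under all multiplications by the `cl (s i)`, and these generate `W̊`
(`mul_sBar_mem_of_piGroup_mem`, `exists_foldl_piGroup_eq`).

This requires that `W̊` is finite and that no `α i` vanishes at `w⁻¹ ρ^∨`. For the latter, `W̊` acts
freely on its chambers (`eq_one_of_mem`), so that no chamber meets the hyperplane of an `α i`, since
`cl (s i)` would fix a common point; and `ρ^∨` lies in the fundamental chamber (`rhoCheck_mem`). The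
constant sign of each `α i` on each chamber also gives the action on the chambers.

These facts come from the theory of finite crystallographic reflection groups, developed here for a
`SimpleSystem`: a basis with integral Cartan numbers and a positive definite form. A norm estimate
that uses the integrality of both roots and coroots shows that every root is positive or negative
(`nonneg_or_nonneg_neg`), and the exchange condition and the free action on chambers follow; the
group is finite since its elements send the basis to lattice points of bounded length.

The form exists since affine Cartan matrices are symmetrizable (`exists_symmetrizer`): by the
inequality of arithmetic and geometric means, the relation `∑ j, M i j * a j = 0` leaves room for at
most as many edges as vertices in the Dynkin diagram, so that it is either a tree or has a symmetric
matrix. The symmetrized form is a sum of squares that degenerates only in one direction, which is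
excluded by discarding the vertex `0` (`quadratic_pos`).
-/

namespace AffineWeyl

/-- A simple system in a real vector space `E`: a basis of simple roots at pairwise obtuse angles for
a positive definite form, with integral Cartan numbers `2 (b k, b l) / (b l, b l)`. The group
generated by the reflections in the basis vectors is then a finite crystallographic reflection
group, but neither the finiteness nor the positivity of roots is part of the data. -/
structure SimpleSystem (ι E : Type*) [Fintype ι] [AddCommGroup E] [Module ℝ E] where
  /-- The simple roots. -/
  basis : Module.Basis ι ℝ E
  /-- The invariant inner product. -/
  form : LinearMap.BilinForm ℝ E
  symm : ∀ x y, form x y = form y x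
  pos : ∀ x, x ≠ 0 → 0 < form x x
  /-- The Cartan number `cartan k l`, the value of the `l`-th simple coroot on the `k`-th simple
  root. -/
  cartan : ι → ι → ℤ
  two_mul_form : ∀ k l,
    2 * form (basis k) (basis l) = cartan k l * form (basis l) (basis l)
  cartan_nonpos : ∀ k l, k ≠ l → cartan k l ≤ 0

namespace SimpleSystem

/-! ### Reflections and words -/

variable {ι E : Type*} [Fintype ι] [AddCommGroup E] [Module ℝ E] (S : SimpleSystem ι E)

theorem form_basis_pos (k : ι) : 0 < S.form (S.basis k) (S.basis k) :=
  S.pos _ (S.basis.ne_zero k)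

theorem form_basis_nonpos {k l : ι} (h : k ≠ l) : S.form (S.basis k) (S.basis l) ≤ 0 := by
  have h1 := S.two_mul_form k l
  have h2 : (S.cartan k l : ℝ) ≤ 0 := by exact_mod_cast S.cartan_nonpos k l h
  nlinarith [mul_nonneg (neg_nonneg.2 h2) (S.form_basis_pos l).le]

theorem form_nonneg (x : E) : 0 ≤ S.form x x := by
  by_cases h : x = 0
  · simp [h]
  · exact (S.pos x h).le

/-- The reflection in the hyperplane orthogonal to the `k`-th simple root. -/
noncomputable def refl (k : ι) : E ≃ₗ[ℝ] E :=
  Module.reflection (x := S.basis k)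
    (f := (2 / S.form (S.basis k) (S.basis k)) • S.form (S.basis k))
    (by simp [div_mul_cancel₀ _ (S.form_basis_pos k).ne'])

theorem refl_apply (k : ι) (x : E) : S.refl k x =
    x - (2 / S.form (S.basis k) (S.basis k) * S.form x (S.basis k)) • S.basis k := by
  simp [refl, Module.reflection_apply, S.symm x]

theorem refl_refl (k : ι) (x : E) : S.refl k (S.refl k x) = x :=
  Module.involutive_reflection _ x

theorem refl_mul_self (k : ι) : S.refl k * S.refl k = 1 :=
  LinearEquiv.ext (S.refl_refl k)

theorem refl_basis_self (k : ι) : S.refl k (S.basis k) = -S.basis k := by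
  rw [refl_apply, div_mul_cancel₀ _ (S.form_basis_pos k).ne']; module

theorem form_refl_refl (k : ι) (x y : E) : S.form (S.refl k x) (S.refl k y) = S.form x y := by
  have h := (S.form_basis_pos k).ne'
  simp only [refl_apply, map_sub, map_smul, LinearMap.sub_apply, LinearMap.smul_apply, smul_eq_mul,
    S.symm (S.basis k) y]
  field_simp
  ring

theorem refl_repr_of_ne {i k : ι} (h : k ≠ i) (x : E) :
    S.basis.repr (S.refl i x) k = S.basis.repr x k := by
  simp [refl_apply, Module.Basis.repr_self, h.symm]

theorem refl_repr_self (i : ι) (x : E) : S.basis.repr (S.refl i x) i =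
    S.basis.repr x i - 2 / S.form (S.basis i) (S.basis i) * S.form x (S.basis i) := by
  simp [refl_apply, Module.Basis.repr_self]

theorem form_eq_sum (x y : E) : S.form x y = ∑ l, S.basis.repr x l * S.form (S.basis l) y := by
  conv_lhs => rw [← S.basis.sum_repr x]
  simp only [map_sum, map_smul, LinearMap.sum_apply, LinearMap.smul_apply, smul_eq_mul]

/-- The group element spelled by a word in the simple reflections. -/
noncomputable def word (l : List ι) : E ≃ₗ[ℝ] E := (l.map S.refl).prod

@[simp] theorem word_nil : S.word [] = 1 := rfl

theorem word_nil_apply (x : E) : S.word [] x = x := rfl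

theorem word_cons (i : ι) (l : List ι) : S.word (i :: l) = S.refl i * S.word l := rfl

theorem word_append (l m : List ι) : S.word (l ++ m) = S.word l * S.word m := by
  simp [word]

theorem word_cons_apply (i : ι) (l : List ι) (x : E) :
    S.word (i :: l) x = S.refl i (S.word l x) := rfl

theorem exists_word_of_mem_closure {w : E ≃ₗ[ℝ] E}
    (hw : w ∈ Subgroup.closure (Set.range S.refl)) : ∃ l, w = S.word l := by
  induction hw using Subgroup.closure_induction with
  | mem w hw =>
    obtain ⟨i, rfl⟩ := hw
    exact ⟨[i], by simp [word]⟩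
  | one => exact ⟨[], rfl⟩
  | mul u v _ _ hu hv =>
    obtain ⟨l, rfl⟩ := hu
    obtain ⟨m, rfl⟩ := hv
    exact ⟨l ++ m, (S.word_append l m).symm⟩
  | inv u _ hu =>
    obtain ⟨l, rfl⟩ := hu
    refine ⟨l.reverse, ?_⟩
    rw [word, word, List.prod_inv_reverse, List.map_reverse, List.map_map]
    congr 2

theorem form_word (l : List ι) (x y : E) : S.form (S.word l x) (S.word l y) = S.form x y := by
  induction l with
  | nil => rfl
  | cons i l ih => rw [word_cons_apply, word_cons_apply, form_refl_refl, ih]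

/-! ### Positivity of roots -/

/-- Roots are integral combinations of the simple roots. -/
theorem exists_repr_word (l : List ι) (j k : ι) :
    ∃ m : ℤ, S.basis.repr (S.word l (S.basis j)) k = m := by
  classical
  induction l generalizing k with
  | nil => exact ⟨if j = k then 1 else 0, by simp [Finsupp.single_apply]⟩
  | cons i l ih =>
    rw [word_cons_apply]
    by_cases hk : k = i
    · subst hk
      choose m hm using ih
      refine ⟨m k - ∑ l, m l * S.cartan l k, ?_⟩
      rw [refl_repr_self, S.form_eq_sum (S.word l _)]
      push_cast
      rw [hm, Finset.mul_sum]
      congr 1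
      refine Finset.sum_congr rfl fun p _ => ?_
      have h := (S.form_basis_pos k).ne'
      have h2 := S.two_mul_form p k
      rw [hm]
      field_simp
      linear_combination (m p : ℝ) * h2
    · rw [S.refl_repr_of_ne hk]
      exact ih k

/-- Coroots are integral combinations of the simple coroots: as the coroot of a root `γ` is
`2γ / (γ, γ)`, its coefficients are those of `γ` rescaled by ratios of squared lengths. -/
theorem exists_repr_word_dual (l : List ι) (j k : ι) :
    ∃ m : ℤ, S.basis.repr (S.word l (S.basis j)) k * S.form (S.basis k) (S.basis k) =
      m * S.form (S.basis j) (S.basis j) := by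
  classical
  induction l generalizing k with
  | nil =>
    refine ⟨if j = k then 1 else 0, ?_⟩
    by_cases h : j = k <;> simp [h]
  | cons i l ih =>
    rw [word_cons_apply]
    by_cases hk : k = i
    · subst hk
      choose m hm using ih
      refine ⟨m k - ∑ p, m p * S.cartan k p, ?_⟩
      have h := (S.form_basis_pos k).ne'
      rw [refl_repr_self, sub_mul, hm, div_mul_eq_mul_div, div_mul_cancel₀ _ h,
        S.form_eq_sum (S.word l _)]
      push_cast
      rw [sub_mul, Finset.mul_sum, Finset.sum_mul]
      congr 1
      refine Finset.sum_congr rfl fun p _ => ?_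
      have h2 := S.two_mul_form k p
      rw [S.symm (S.basis p)]
      linear_combination (S.basis.repr (S.word l (S.basis j)) p) * h2 + S.cartan k p * hm p
    · rw [S.refl_repr_of_ne hk]
      exact ih k

/-- A root with a negative coefficient at `i` and no other negative coefficient is a multiple of
the `i`-th simple root. The two integrality statements force the `i`-th component to be at least as
long as the root, while the other components can only lengthen it, the simple roots being at
pairwise obtuse angles. -/
theorem repr_word_eq_zero {l : List ι} {j i : ι}
    (hi : S.basis.repr (S.word l (S.basis j)) i < 0)
    (hpos : ∀ k, k ≠ i → 0 ≤ S.basis.repr (S.word l (S.basis j)) k) :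
    ∀ k, k ≠ i → S.basis.repr (S.word l (S.basis j)) k = 0 := by
  classical
  obtain ⟨m, hm⟩ := S.exists_repr_word l j i
  obtain ⟨m', hm'⟩ := S.exists_repr_word_dual l j i
  have hnorm := S.form_word l (S.basis j) (S.basis j)
  have hj := S.form_basis_pos j
  have hbi := S.form_basis_pos i
  set γ := S.word l (S.basis j) with hγ
  set c := S.basis.repr γ i with hc
  set γ' := γ - c • S.basis i with hγ'
  have hm1 : m ≤ -1 := by
    have : (m : ℝ) < 0 := hm ▸ hi
    have : m < 0 := by exact_mod_cast this
    omega
  have hm1' : m' ≤ -1 := by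
    have h1 : (m' : ℝ) * S.form (S.basis j) (S.basis j) < 0 := by
      rw [← hm']; exact mul_neg_of_neg_of_pos hi hbi
    have : (m' : ℝ) < 0 := by
      by_contra h
      exact absurd (mul_nonneg (not_lt.1 h) hj.le) (not_le.2 h1)
    have : m' < 0 := by exact_mod_cast this
    omega
  have hcm : c ≤ -1 := by rw [hm]; exact_mod_cast hm1
  have hcm' : c * S.form (S.basis i) (S.basis i) ≤ -S.form (S.basis j) (S.basis j) := by
    rw [hm']
    have : (m' : ℝ) ≤ -1 := by exact_mod_cast hm1'
    nlinarith
  have hrepr : ∀ k, k ≠ i → S.basis.repr γ' k = S.basis.repr γ k := by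
    intro k hk
    simp [hγ', hk.symm]
  have hrepri : S.basis.repr γ' i = 0 := by
    simp [hγ', hc]
  have hobt : S.form γ' (S.basis i) ≤ 0 := by
    rw [form_eq_sum]
    refine Finset.sum_nonpos fun k _ => ?_
    by_cases hk : k = i
    · rw [hk, hrepri, zero_mul]
    · rw [hrepr k hk]
      exact mul_nonpos_of_nonneg_of_nonpos (hpos k hk) (S.form_basis_nonpos hk)
  have hexp : S.form γ γ = S.form γ' γ' + 2 * c * S.form γ' (S.basis i) +
      c * c * S.form (S.basis i) (S.basis i) := by
    have : γ = γ' + c • S.basis i := by simp [hγ']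
    rw [this]
    simp only [map_add, map_smul, LinearMap.add_apply, LinearMap.smul_apply, smul_eq_mul,
      S.symm (S.basis i) γ']
    ring
  have hz : γ' = 0 := by
    by_contra hne
    have h1 := S.pos γ' hne
    have h2 : 0 ≤ 2 * c * S.form γ' (S.basis i) := by nlinarith
    have h3 : S.form (S.basis j) (S.basis j) ≤ c * c * S.form (S.basis i) (S.basis i) := by
      nlinarith
    linarith
  intro k hk
  rw [← hrepr k hk, hz]
  simp

theorem word_basis_ne_zero (l : List ι) (j : ι) : S.word l (S.basis j) ≠ 0 :=
  ((S.word l).map_ne_zero_iff).2 (S.basis.ne_zero j)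

/-- The only nonnegative multiple of a simple root that is a root is that simple root: both the
factor and its inverse are integers, by the integrality of roots and of coroots. -/
theorem repr_eq_one_of_smul {l : List ι} {j i : ι} {c : ℝ} (hc : 0 ≤ c)
    (h : S.word l (S.basis j) = c • S.basis i) : c = 1 := by
  obtain ⟨m, hm⟩ := S.exists_repr_word l j i
  obtain ⟨m', hm'⟩ := S.exists_repr_word_dual l j i
  have hnorm := S.form_word l (S.basis j) (S.basis j)
  have hbi := S.form_basis_pos i
  have hne : c ≠ 0 := by
    rintro rfl
    exact S.word_basis_ne_zero l j (by simpa using h)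
  rw [h] at hm hm' hnorm
  simp only [map_smul, Module.Basis.repr_self, Finsupp.smul_apply, Finsupp.single_eq_same,
    smul_eq_mul, mul_one, LinearMap.smul_apply] at hm hm' hnorm
  have h1 : (m' : ℝ) * c = 1 := by
    have : c * S.form (S.basis i) (S.basis i) * (m' * c - 1) = 0 := by
      rw [← hnorm] at hm'
      linear_combination -hm'
    rcases mul_eq_zero.1 this with h | h
    · exact absurd h (mul_ne_zero hne hbi.ne')
    · linarith
  rw [hm] at h1 hc ⊢
  have h2 : m' * m = 1 := by exact_mod_cast h1
  have h3 : 0 ≤ m := by exact_mod_cast hc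
  have h4 : m = 1 := Int.eq_one_of_mul_eq_one_left h3 h2
  rw [h4, Int.cast_one]

/-- The vectors with nonnegative coordinates. -/
def Nonneg (x : E) : Prop := ∀ k, 0 ≤ S.basis.repr x k

/-- A simple reflection keeps every positive root positive, except its own simple root. -/
theorem nonneg_refl {l : List ι} {j : ι} (i : ι) (h : S.Nonneg (S.word l (S.basis j)))
    (hne : S.word l (S.basis j) ≠ S.basis i) : S.Nonneg (S.refl i (S.word l (S.basis j))) := by
  by_contra hneg
  have hk : ∀ k, k ≠ i → 0 ≤ S.basis.repr (S.word (i :: l) (S.basis j)) k := fun k hk => by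
    rw [word_cons_apply, S.refl_repr_of_ne hk]; exact h k
  have hi : S.basis.repr (S.word (i :: l) (S.basis j)) i < 0 := by
    by_contra hi
    refine hneg fun k => ?_
    by_cases hki : k = i
    · subst hki; exact not_lt.1 hi
    · exact hk k hki
  have hz := S.repr_word_eq_zero hi hk
  have heq : S.word l (S.basis j) = S.basis.repr (S.word l (S.basis j)) i • S.basis i := by
    classical
    refine S.basis.ext_elem fun k => ?_
    by_cases hki : k = i
    · subst hki; simp
    · rw [← S.refl_repr_of_ne hki, ← word_cons_apply, hz k hki]
      simp [Ne.symm hki]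
  have h1 := S.repr_eq_one_of_smul (h i) heq
  rw [h1, one_smul] at heq
  exact hne heq

/-- Every root is positive or negative. -/
theorem nonneg_or_nonneg_neg (l : List ι) (j : ι) :
    S.Nonneg (S.word l (S.basis j)) ∨ S.Nonneg (-S.word l (S.basis j)) := by
  classical
  have hb : ∀ i, S.Nonneg (S.basis i) := fun i k => by
    simp only [Module.Basis.repr_self, Finsupp.single_apply]; split_ifs <;> simp
  induction l with
  | nil => exact Or.inl (hb j)
  | cons i l ih =>
    rw [word_cons_apply]
    -- The negative of the root `w bⱼ` is the root `w sⱼ bⱼ`.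
    have hneg : -S.word l (S.basis j) = S.word (l ++ [j]) (S.basis j) := by
      rw [word_append, LinearEquiv.mul_apply, word_cons_apply, word_nil_apply,
        refl_basis_self, map_neg]
    rcases ih with h | h
    · by_cases hne : S.word l (S.basis j) = S.basis i
      · right
        rw [hne, refl_basis_self, neg_neg]
        exact hb i
      · exact Or.inl (S.nonneg_refl i h hne)
    · by_cases hne : -S.word l (S.basis j) = S.basis i
      · left
        rw [← neg_neg (S.word l (S.basis j)), hne, map_neg, refl_basis_self, neg_neg]
        exact hb i
      · right
        rw [← map_neg]
        rw [hneg] at h hne ⊢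
        exact S.nonneg_refl i h hne

theorem not_nonneg_neg_of_nonneg {x : E} (hx : x ≠ 0) (h : S.Nonneg x) : ¬ S.Nonneg (-x) := by
  intro h'
  refine hx (S.basis.ext_elem fun k => ?_)
  have h1 := h k
  have h2 := h' k
  simp only [map_neg, Finsupp.neg_apply] at h2
  simp only [map_zero, Finsupp.zero_apply]
  linarith

/-! ### Exchange condition and free action on chambers -/

/-- If a word sends one simple root to another, it conjugates the reflections accordingly. -/
theorem refl_mul_word {l : List ι} {i j : ι} (h : S.word l (S.basis j) = S.basis i) :
    S.refl i * S.word l = S.word l * S.refl j := by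
  refine LinearEquiv.ext fun x => ?_
  simp only [LinearEquiv.mul_apply, refl_apply, map_sub, map_smul, ← h, S.form_word]

/-- The exchange condition: if `w bⱼ` is a negative root, then `w sⱼ` is spelled by a shorter
word. -/
theorem exists_shorter_word {l : List ι} {j : ι} (h : S.Nonneg (-S.word l (S.basis j))) :
    ∃ l' : List ι, l'.length < l.length ∧ S.word l' = S.word l * S.refl j := by
  classical
  induction l with
  | nil =>
    exfalso
    have := h j
    simp only [word_nil_apply, map_neg, Module.Basis.repr_self,
      Finsupp.neg_apply, Finsupp.single_eq_same] at this
    linarith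
  | cons i l ih =>
    rcases S.nonneg_or_nonneg_neg l j with h' | h'
    · have heq : S.word l (S.basis j) = S.basis i := by
        by_contra hne
        exact S.not_nonneg_neg_of_nonneg (S.word_basis_ne_zero (i :: l) j)
          (S.nonneg_refl i h' hne) h
      refine ⟨l, by simp, ?_⟩
      rw [word_cons, mul_assoc, ← S.refl_mul_word heq, ← mul_assoc, refl_mul_self, one_mul]
    · obtain ⟨l', hl, hw⟩ := ih h'
      exact ⟨i :: l', by simpa using hl, by rw [word_cons, hw, word_cons, mul_assoc]⟩

/-- An element that keeps all simple roots positive is trivial. -/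
theorem word_eq_one (l : List ι) (h : ∀ j, S.Nonneg (S.word l (S.basis j))) : S.word l = 1 := by
  induction hn : l.length using Nat.strong_induction_on generalizing l with
  | _ N ih =>
    rcases l.eq_nil_or_concat with rfl | ⟨t, j, rfl⟩
    · rfl
    · rw [List.concat_eq_append] at *
      have hw : S.word (t ++ [j]) = S.word t * S.refl j := by
        rw [word_append, word_cons, word_nil, mul_one]
      have hneg : S.Nonneg (-S.word t (S.basis j)) := by
        have := h j
        rwa [hw, LinearEquiv.mul_apply, refl_basis_self, map_neg] at this
      obtain ⟨l', hl, hw'⟩ := S.exists_shorter_word hneg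
      rw [hw, ← hw']
      refine ih l'.length ?_ l' ?_ rfl
      · rw [← hn]; simp; omega
      · intro k; rw [hw', ← hw]; exact h k

/-- The open fundamental chamber. -/
def chamber : Set E := {x | ∀ k, 0 < S.form x (S.basis k)}

/-- The group acts freely on the translates of the fundamental chamber. -/
theorem word_eq_one_of_mem_chamber {l : List ι} {x : E} (hx : x ∈ S.chamber)
    (hwx : S.word l x ∈ S.chamber) : S.word l = 1 := by
  refine S.word_eq_one l fun j => (S.nonneg_or_nonneg_neg l j).resolve_right fun hneg => ?_
  have h1 : 0 < S.form (S.word l (S.basis j)) (S.word l x) := by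
    rw [form_word, S.symm]; exact hx j
  rw [form_eq_sum] at h1
  refine absurd h1 (not_lt.2 (Finset.sum_nonpos fun k _ => ?_))
  have h2 := hneg k
  simp only [map_neg, Finsupp.neg_apply] at h2
  rw [S.symm]
  exact mul_nonpos_of_nonpos_of_nonneg (by linarith) (hwx k).le

/-! ### Finiteness, and the sum of the positive roots -/

/-- Lattice points of bounded length are finite in number. -/
theorem finite_integral_le (R : ℝ) :
    {x : E | (∀ k, ∃ m : ℤ, S.basis.repr x k = m) ∧ S.form x x ≤ R}.Finite := by
  classical
  have hnd : S.form.Nondegenerate := by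
    refine ⟨fun x hx => ?_, fun x hx => ?_⟩ <;>
    · by_contra h
      exact (S.pos x h).ne' (hx x)
  -- By Cauchy-Schwarz against the dual basis, the coordinates are bounded.
  set d := S.form.dualBasis hnd S.basis with hd
  have hrepr : ∀ x k, S.basis.repr x k = S.form (d k) x := fun x k => by
    conv_rhs => rw [← S.basis.sum_repr x]
    simp only [map_sum, map_smul, hd, LinearMap.BilinForm.apply_dualBasis_left, smul_eq_mul,
      mul_ite, mul_one, mul_zero, Finset.sum_ite_eq', Finset.mem_univ, if_true]
  have hbound : ∀ k, ∃ N : ℕ, ∀ x, S.form x x ≤ R → |S.basis.repr x k| ≤ N := fun k => by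
    obtain ⟨N, hN⟩ := exists_nat_ge (S.form (d k) (d k) * R + 1)
    refine ⟨N, fun x hx => ?_⟩
    have hcs := LinearMap.BilinForm.apply_mul_apply_le_of_forall_zero_le S.form S.form_nonneg
      (d k) x
    rw [S.symm x (d k), ← hrepr] at hcs
    have h1 := mul_le_mul_of_nonneg_left hx (S.form_nonneg (d k))
    have h2 := abs_mul_abs_self (S.basis.repr x k)
    nlinarith [abs_nonneg (S.basis.repr x k), sq_nonneg (|S.basis.repr x k| - 1)]
  choose N hN using hbound
  refine Set.Finite.subset (Set.Finite.image
    (fun m : ι → ℤ => ∑ k, (m k : ℝ) • S.basis k)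
    (Set.finite_Icc (fun k => -(N k : ℤ)) (fun k => (N k : ℤ)))) ?_
  rintro x ⟨hint, hx⟩
  choose m hm using hint
  have hb : ∀ k, |m k| ≤ N k := fun k => by
    have := hN k x hx
    rw [hm] at this
    exact_mod_cast this
  refine ⟨m, ⟨fun k => (abs_le.1 (hb k)).1, fun k => (abs_le.1 (hb k)).2⟩, ?_⟩
  simp only [← hm]
  exact S.basis.sum_repr x

theorem finite_closure : Finite (Subgroup.closure (Set.range S.refl)) := by
  have hfin := fun j => S.finite_integral_le (S.form (S.basis j) (S.basis j))
  have : ∀ j, Finite _ := fun j => (hfin j).to_subtype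
  refine Finite.of_injective (β := ∀ j, {x : E | (∀ k, ∃ m : ℤ, S.basis.repr x k = m) ∧
    S.form x x ≤ S.form (S.basis j) (S.basis j)}) (fun w j => ⟨w.1 (S.basis j), ?_⟩) ?_
  · obtain ⟨l, hl⟩ := S.exists_word_of_mem_closure w.2
    rw [hl]
    exact ⟨S.exists_repr_word l j, (S.form_word l _ _).le⟩
  · intro w w' h
    refine Subtype.ext (LinearEquiv.toLinearMap_injective (S.basis.ext fun j => ?_))
    exact congrArg Subtype.val (congrFun h j)

/-- The positive roots. -/
def positiveRoots : Set E :=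
  {β | (∃ l j, β = S.word l (S.basis j)) ∧ S.Nonneg β}

theorem finite_positiveRoots : S.positiveRoots.Finite := by
  refine Set.Finite.subset (Set.finite_iUnion fun j =>
    S.finite_integral_le (S.form (S.basis j) (S.basis j))) ?_
  rintro _ ⟨⟨l, j, rfl⟩, -⟩
  exact Set.mem_iUnion.2 ⟨j, S.exists_repr_word l j, (S.form_word l _ _).le⟩

theorem basis_mem_positiveRoots (i : ι) : S.basis i ∈ S.positiveRoots := by
  classical
  refine ⟨⟨[], i, rfl⟩, fun k => ?_⟩
  simp only [Module.Basis.repr_self, Finsupp.single_apply]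
  split_ifs <;> simp

/-- The sum of the positive roots lies in the fundamental chamber: the `i`-th simple reflection
permutes the positive roots other than the `i`-th simple root, so that these contribute zero to the
product with that root. -/
theorem finsum_positiveRoots_mem_chamber :
    ∑ᶠ β ∈ S.positiveRoots, β ∈ S.chamber := by
  classical
  intro i
  rw [finsum_mem_eq_finite_toFinset_sum _ S.finite_positiveRoots, map_sum, LinearMap.sum_apply,
    ← Finset.add_sum_erase (a := S.basis i) _ _
      ((Set.Finite.mem_toFinset _).2 (S.basis_mem_positiveRoots i))]
  have hrefl : ∀ x, S.form (S.refl i x) (S.basis i) = -S.form x (S.basis i) := fun x => by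
    have h := S.form_refl_refl i (S.refl i x) (S.basis i)
    rw [refl_refl, refl_basis_self, map_neg] at h
    exact h.symm
  have hzero : ∑ β ∈ S.finite_positiveRoots.toFinset.erase (S.basis i),
      S.form β (S.basis i) = 0 := by
    refine Finset.sum_involution (fun β _ => S.refl i β) ?_ ?_ ?_ ?_
    · intro β _; rw [hrefl, add_neg_cancel]
    · intro β _ hne heq
      have := hrefl β
      rw [heq] at this
      exact hne (by linarith)
    · intro β hβ
      obtain ⟨hne, hβ⟩ := Finset.mem_erase.1 hβ
      obtain ⟨⟨l, j, rfl⟩, hβ⟩ := (Set.Finite.mem_toFinset _).1 hβ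
      refine Finset.mem_erase.2 ⟨fun h => ?_, (Set.Finite.mem_toFinset _).2
        ⟨⟨i :: l, j, rfl⟩, S.nonneg_refl i hβ hne⟩⟩
      have h2 : S.word l (S.basis j) = -S.basis i := by
        rw [← refl_basis_self, ← h, refl_refl]
      refine S.not_nonneg_neg_of_nonneg (S.basis.ne_zero i) (S.basis_mem_positiveRoots i).2 ?_
      rwa [← h2]
    · intro β _; exact S.refl_refl i β
  rw [hzero, add_zero]
  exact S.form_basis_pos i

end SimpleSystem

namespace AffineCartanMatrix

variable {n : ℕ} (D : AffineCartanMatrix n)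

/-! ### Symmetrization of affine Cartan matrices -/

theorem a_pos_real (i : Fin (n + 1)) : 0 < (D.a i : ℝ) := by exact_mod_cast D.a_pos i

theorem sum_M_mul_a (i : Fin (n + 1)) : ∑ j, (D.M i j : ℝ) * D.a j = 0 := by
  exact_mod_cast D.a_null i

theorem M_le_neg_one {i j : Fin (n + 1)} (hij : i ≠ j) (h : D.M i j ≠ 0) : D.M i j ≤ -1 := by
  have := D.offDiag_nonpos i j hij
  omega

/-- A property that propagates along the edges of the Dynkin diagram holds everywhere once it holds
somewhere. -/
theorem forall_of_edges {P : Fin (n + 1) → Prop} {i₀ : Fin (n + 1)} (h₀ : P i₀)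
    (h : ∀ i j, i ≠ j → D.M i j ≠ 0 → P i → P j) (i : Fin (n + 1)) : P i := by
  by_contra hi
  obtain ⟨k, hk, j, hj, hkj⟩ := D.indecomposable {i | P i} ⟨i₀, h₀⟩ ⟨i, hi⟩
  refine hj (h k j ?_ hkj hk)
  rintro rfl
  exact hj hk

/-- The edges of the Dynkin diagram. -/
def edges : Finset (Fin (n + 1) × Fin (n + 1)) :=
  Finset.univ.filter fun p => p.1 < p.2 ∧ D.M p.1 p.2 ≠ 0

theorem mem_edges {p : Fin (n + 1) × Fin (n + 1)} :
    p ∈ D.edges ↔ p.1 < p.2 ∧ D.M p.1 p.2 ≠ 0 := by simp [edges]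

/-- If the Dynkin diagram has fewer edges than vertices, it is a tree, and any function on its
edges is a coboundary. -/
theorem exists_potential (hE : D.edges.card ≤ n) (f : Fin (n + 1) → Fin (n + 1) → ℝ) :
    ∃ x : Fin (n + 1) → ℝ, ∀ i j, i < j → D.M i j ≠ 0 → x i - x j = f i j := by
  let δ : (Fin (n + 1) → ℝ) →ₗ[ℝ] (D.edges → ℝ) :=
    LinearMap.funLeft ℝ ℝ (fun p : D.edges => p.1.1) -
      LinearMap.funLeft ℝ ℝ (fun p : D.edges => p.1.2)
  have hδ : ∀ x p, δ x p = x p.1.1 - x p.1.2 := fun _ _ => rfl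
  have hker : LinearMap.ker δ ≤ Submodule.span ℝ {fun _ => (1 : ℝ)} := by
    intro x hx
    have hx' : ∀ p : D.edges, x p.1.1 - x p.1.2 = 0 := fun p => by
      rw [← hδ, LinearMap.mem_ker.1 hx]; rfl
    have hconst : ∀ i, x i = x 0 := by
      refine D.forall_of_edges (i₀ := 0) rfl fun i j hij hM hi => ?_
      rw [← hi]
      rcases lt_or_gt_of_ne hij with h | h
      · have := hx' ⟨(i, j), D.mem_edges.2 ⟨h, hM⟩⟩
        simp only at this
        linarith
      · have := hx' ⟨(j, i), D.mem_edges.2 ⟨h, fun h' => hM (D.zero_symm _ _ h')⟩⟩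
        simp only at this
        linarith
    refine Submodule.mem_span_singleton.2 ⟨x 0, funext fun i => ?_⟩
    simp [hconst i]
  have h1 : Module.finrank ℝ (LinearMap.ker δ) ≤ 1 :=
    (Submodule.finrank_mono hker).trans ((finrank_span_le_card _).trans (by simp))
  have h2 := LinearMap.finrank_range_add_finrank_ker δ
  rw [Module.finrank_fin_fun] at h2
  have h3 : LinearMap.range δ = ⊤ := by
    refine Submodule.eq_top_of_finrank_eq (le_antisymm (Submodule.finrank_le _) ?_)
    rw [Module.finrank_fintype_fun_eq_card, Fintype.card_coe]
    omega
  obtain ⟨x, hx⟩ := LinearMap.range_eq_top.1 h3 fun p => f p.1.1 p.1.2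
  exact ⟨x, fun i j hij hM => congrFun hx ⟨(i, j), D.mem_edges.2 ⟨hij, hM⟩⟩⟩

/-- An affine Cartan matrix is symmetrizable. Put `u i j = -M i j * a j / a i`, so that the `u i j`
with `j ≠ i` have sum `2`. On every edge `u i j * u j i ≥ 1`, so that `u i j + u j i ≥ 2`; summing
up, the Dynkin diagram has at most as many edges as vertices. In case of equality, all `u i j` are
`1` and the matrix is symmetric; otherwise the diagram is a tree. -/
theorem exists_symmetrizer : ∃ ε : Fin (n + 1) → ℝ, (∀ i, 0 < ε i) ∧
    ∀ i j, (D.M i j : ℝ) * ε j = D.M j i * ε i := by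
  rcases Nat.lt_or_ge n D.edges.card with hE | hE
  · refine ⟨fun _ => 1, fun _ => one_pos, ?_⟩
    have ha := D.a_pos_real
    set u : Fin (n + 1) → Fin (n + 1) → ℝ := fun i j => -(D.M i j : ℝ) * D.a j / D.a i with hu
    have hprod : ∀ i j, u i j * u j i = D.M i j * D.M j i := fun i j => by
      have h1 := (ha i).ne'
      have h2 := (ha j).ne'
      simp only [hu]
      field_simp
    have hge : ∀ p ∈ D.edges, 1 ≤ u p.1 p.2 * u p.2 p.1 ∧ 2 ≤ u p.1 p.2 + u p.2 p.1 := by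
      rintro ⟨i, j⟩ hp
      obtain ⟨hij, hM⟩ := D.mem_edges.1 hp
      simp only at hij hM ⊢
      have h1 := D.M_le_neg_one hij.ne hM
      have h2 := D.M_le_neg_one hij.ne' fun h => hM (D.zero_symm _ _ h)
      have h1' : (D.M i j : ℝ) ≤ -1 := by exact_mod_cast h1
      have h2' : (D.M j i : ℝ) ≤ -1 := by exact_mod_cast h2
      have h3 : 1 ≤ u i j * u j i := by rw [hprod]; nlinarith
      have h4 : 0 < u i j := div_pos (mul_pos (by linarith) (ha j)) (ha i)
      have h5 : 0 < u j i := div_pos (mul_pos (by linarith) (ha i)) (ha j)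
      exact ⟨h3, by nlinarith [sq_nonneg (u i j - u j i)]⟩
    have hrow : ∀ i, ∑ j, u i j = 0 := fun i => by
      have : ∑ j, u i j = -(∑ j, (D.M i j : ℝ) * D.a j) / D.a i := by
        rw [← Finset.sum_neg_distrib, Finset.sum_div]
        exact Finset.sum_congr rfl fun j _ => by simp only [hu]; ring
      rw [this, D.sum_M_mul_a, neg_zero, zero_div]
    have hdiag : ∀ i, u i i = -2 := fun i => by
      simp only [hu, D.diag]
      have h1 := (ha i).ne'
      field_simp
      norm_num
    have hlt : ∑ p : Fin (n + 1) × Fin (n + 1), (if p.1 < p.2 then u p.1 p.2 + u p.2 p.1 else 0) =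
        2 * (n + 1) := by
      have hsplit : ∀ i j, u i j = (if i < j then u i j else 0) + (if j < i then u i j else 0) +
          (if i = j then -2 else 0) := fun i j => by
        rcases lt_trichotomy i j with h | h | h
        · simp [h, h.ne, h.not_gt]
        · subst h; simp [hdiag]
        · simp [h, h.ne', h.not_gt]
      have htot : ∑ i, ∑ j, u i j = 0 := Finset.sum_eq_zero fun i _ => hrow i
      rw [Finset.sum_congr rfl fun i _ => Finset.sum_congr rfl fun j _ => hsplit i j] at htot
      simp only [Finset.sum_add_distrib] at htot
      rw [Finset.sum_comm (f := fun i j => if j < i then u i j else 0)] at htot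
      simp only [Finset.sum_ite_eq, Finset.mem_univ, if_true, Finset.sum_const, Finset.card_univ,
        Fintype.card_fin, nsmul_eq_mul] at htot
      rw [Fintype.sum_prod_type]
      have : ∀ i j, (if i < j then u i j + u j i else 0) =
          (if i < j then u i j else 0) + (if i < j then u j i else 0) := fun i j => by
        split_ifs <;> simp
      simp_rw [this, Finset.sum_add_distrib]
      push_cast at htot
      linarith
    have hsum : ∑ p ∈ D.edges, (u p.1 p.2 + u p.2 p.1) = 2 * (n + 1) := by
      rw [← hlt, edges, Finset.sum_filter]
      refine Finset.sum_congr rfl fun p _ => ?_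
      by_cases h : p.1 < p.2
      · by_cases hM : D.M p.1 p.2 = 0
        · simp [hu, hM, D.zero_symm _ _ hM]
        · simp [h, hM]
      · simp [h]
    have hle : ∑ p ∈ D.edges, (u p.1 p.2 + u p.2 p.1) ≤ ∑ p ∈ D.edges, (2 : ℝ) := by
      rw [hsum, Finset.sum_const, nsmul_eq_mul, mul_comm]
      have : (n : ℝ) + 1 ≤ D.edges.card := by exact_mod_cast hE
      linarith
    have heq := (Finset.sum_eq_sum_iff_of_le fun p hp => (hge p hp).2).1
      (le_antisymm (Finset.sum_le_sum fun p hp => (hge p hp).2) hle)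
    have key : ∀ i j, i < j → D.M i j = D.M j i := by
      intro i j hij
      by_cases hM : D.M i j = 0
      · rw [hM, D.zero_symm _ _ hM]
      · have hp : (i, j) ∈ D.edges := D.mem_edges.2 ⟨hij, hM⟩
        have h1 := (hge _ hp).1
        have h2 := heq _ hp
        simp only at h1 h2
        have h3 := D.M_le_neg_one hij.ne hM
        have h4 := D.M_le_neg_one hij.ne' fun h => hM (D.zero_symm _ _ h)
        have h5 : (D.M i j : ℝ) * D.M j i ≤ 1 := by
          rw [← hprod]
          nlinarith [sq_nonneg (u i j - u j i)]
        have h6 : D.M i j * D.M j i ≤ 1 := by exact_mod_cast h5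
        have h7 : D.M i j = -1 := by nlinarith
        have h8 : D.M j i = -1 := by nlinarith
        rw [h7, h8]
    intro i j
    rcases lt_trichotomy i j with h | h | h
    · rw [key i j h]
    · rw [h]
    · rw [key j i h]
  · obtain ⟨x, hx⟩ := D.exists_potential hE
      fun i j => Real.log ((D.M i j : ℝ) / D.M j i)
    have key : ∀ i j, i < j →
        (D.M i j : ℝ) * Real.exp (x j) = D.M j i * Real.exp (x i) := by
      intro i j hij
      by_cases hM : D.M i j = 0
      · simp [hM, D.zero_symm _ _ hM]
      · have h1 := D.M_le_neg_one hij.ne hM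
        have h2 := D.M_le_neg_one hij.ne' fun h => hM (D.zero_symm _ _ h)
        have h1' : (D.M i j : ℝ) < 0 := by exact_mod_cast (by omega : D.M i j < 0)
        have h2' : (D.M j i : ℝ) < 0 := by exact_mod_cast (by omega : D.M j i < 0)
        have h4 := h2'.ne
        have h3 : x i = x j + Real.log ((D.M i j : ℝ) / D.M j i) := by
          rw [← hx i j hij hM]; ring
        rw [h3, Real.exp_add, Real.exp_log (div_pos_of_neg_of_neg h1' h2')]
        field_simp
    refine ⟨fun i => Real.exp (x i), fun i => Real.exp_pos _, fun i j => ?_⟩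
    rcases lt_trichotomy i j with h | h | h
    · exact key i j h
    · rw [h]
    · exact (key j i h).symm

/-- The quadratic form of the symmetrized matrix is a sum of squares along the edges of the Dynkin
diagram, so that it vanishes only on the multiples of one vector with nonzero entries. -/
theorem quadratic_pos {ε : Fin (n + 1) → ℝ} (hε : ∀ i, 0 < ε i)
    (hsymm : ∀ i j, (D.M i j : ℝ) * ε j = D.M j i * ε i) {c : Fin (n + 1) → ℝ} (h₀ : c 0 = 0)
    (hc : c ≠ 0) : 0 < ∑ i, ∑ j, c i * c j * (D.M i j * ε j) := by
  have ha := D.a_pos_real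
  set z : Fin (n + 1) → ℝ := fun i => ε i * c i / D.a i with hz
  set p : Fin (n + 1) → Fin (n + 1) → ℝ := fun i j => -(D.M i j * D.a i * D.a j / ε i) with hp
  have hpsymm : ∀ i j, p i j = p j i := fun i j => by
    have h1 := (hε i).ne'
    have h2 := (hε j).ne'
    simp only [hp]
    field_simp
    linear_combination (-(D.a i : ℝ) * D.a j) * hsymm i j
  have hrow : ∀ i, ∑ j, p i j = 0 := fun i => by
    have : ∑ j, p i j = -(D.a i / ε i) * ∑ j, (D.M i j : ℝ) * D.a j := by
      rw [Finset.mul_sum]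
      exact Finset.sum_congr rfl fun j _ => by simp only [hp]; ring
    rw [this, D.sum_M_mul_a, mul_zero]
  have hnonneg : ∀ i j, 0 ≤ p i j * (z i - z j) ^ 2 := fun i j => by
    by_cases hij : i = j
    · simp [hij]
    · refine mul_nonneg ?_ (sq_nonneg _)
      have h1 : (D.M i j : ℝ) ≤ 0 := by exact_mod_cast D.offDiag_nonpos i j hij
      have h2 := div_pos (mul_pos (ha i) (ha j)) (hε i)
      have h3 : p i j = -(D.M i j : ℝ) * (D.a i * D.a j / ε i) := by simp only [hp]; ring
      rw [h3]
      exact mul_nonneg (by linarith) h2.le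
  have hQ : ∑ i, ∑ j, c i * c j * (D.M i j * ε j) =
      (1 / 2) * ∑ i, ∑ j, p i j * (z i - z j) ^ 2 := by
    have h1 : ∑ i, ∑ j, p i j * z i ^ 2 = 0 :=
      Finset.sum_eq_zero fun i _ => by rw [← Finset.sum_mul, hrow, zero_mul]
    have h2 : ∑ i, ∑ j, p i j * z j ^ 2 = 0 := by
      rw [Finset.sum_comm]
      refine Finset.sum_eq_zero fun j _ => ?_
      simp_rw [fun i => hpsymm i j]
      rw [← Finset.sum_mul, hrow, zero_mul]
    have h3 : ∀ i j, p i j * (z i - z j) ^ 2 =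
        p i j * z i ^ 2 + p i j * z j ^ 2 + 2 * (c i * c j * (D.M i j * ε j)) := fun i j => by
      have h4 : p i j * (z i * z j) = -(c i * c j * (D.M i j * ε j)) := by
        have h1 := (hε i).ne'
        have h2 := (ha i).ne'
        have h3 := (ha j).ne'
        simp only [hp, hz]
        field_simp
      linear_combination (-2) * h4
    simp_rw [h3, Finset.sum_add_distrib, ← Finset.mul_sum]
    rw [h1, h2]
    ring
  rw [hQ]
  by_contra hneg
  have hzero : ∑ i, ∑ j, p i j * (z i - z j) ^ 2 = 0 :=
    le_antisymm (by linarith) (Finset.sum_nonneg fun i _ => Finset.sum_nonneg fun j _ => hnonneg i j)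
  have hall : ∀ i j, p i j * (z i - z j) ^ 2 = 0 := fun i j =>
    (Finset.sum_eq_zero_iff_of_nonneg fun j _ => hnonneg i j).1
      ((Finset.sum_eq_zero_iff_of_nonneg fun i _ =>
        Finset.sum_nonneg fun j _ => hnonneg i j).1 hzero i (Finset.mem_univ i)) j
      (Finset.mem_univ j)
  have hz0 : ∀ i, z i = 0 := by
    refine D.forall_of_edges (i₀ := 0) (by simp [hz, h₀]) fun i j _ hM hi => ?_
    have hpne : p i j ≠ 0 := by
      simp only [hp]
      exact neg_ne_zero.2 (div_ne_zero (mul_ne_zero (mul_ne_zero (by exact_mod_cast hM)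
        (ha i).ne') (ha j).ne') (hε i).ne')
    have := pow_eq_zero_iff (two_ne_zero) |>.1 ((mul_eq_zero.1 (hall i j)).resolve_left hpne)
    linarith
  refine hc (funext fun i => ?_)
  have := hz0 i
  simp only [hz, div_eq_zero_iff, mul_eq_zero, (hε i).ne', (ha i).ne', false_or, or_false] at this
  exact this

/-! ### The simple system of the level zero hyperplane -/

/-- Positive numbers proportional to the squared lengths of the simple coroots. -/
noncomputable def symmetrizer : Fin (n + 1) → ℝ := D.exists_symmetrizer.choose

theorem symmetrizer_pos (i : Fin (n + 1)) : 0 < D.symmetrizer i :=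
  D.exists_symmetrizer.choose_spec.1 i

theorem M_mul_symmetrizer (i j : Fin (n + 1)) :
    (D.M i j : ℝ) * D.symmetrizer j = D.M j i * D.symmetrizer i :=
  D.exists_symmetrizer.choose_spec.2 i j

theorem quadratic_succ_pos {c : Fin n → ℝ} (hc : c ≠ 0) :
    0 < ∑ k, ∑ l, c k * c l * ((D.M k.succ l.succ : ℝ) * D.symmetrizer l.succ) := by
  have h := D.quadratic_pos D.symmetrizer_pos D.M_mul_symmetrizer (c := Fin.cons 0 c) rfl
    fun h => hc (funext fun k => by simpa using congrFun h k.succ)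
  simpa [Fin.sum_univ_succ] using h

theorem linearIndependent_simpleCorootZero :
    LinearIndependent ℝ fun k : Fin n => D.simpleCorootZero k.succ := by
  rw [Fintype.linearIndependent_iff]
  intro c hc
  by_contra hne
  have hpos := D.quadratic_succ_pos (c := c) fun h => hne fun k => congrFun h k
  have hz : ∀ l : Fin n, ∑ k, c k * (D.M k.succ l.succ : ℝ) = 0 := fun l => by
    have h := congrFun (congrArg Subtype.val hc) l.succ
    simpa [simpleCorootZero, simpleCoroot] using h
  rw [Finset.sum_comm] at hpos
  refine hpos.ne' (Finset.sum_eq_zero fun l _ => ?_)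
  calc ∑ k, c k * c l * ((D.M k.succ l.succ : ℝ) * D.symmetrizer l.succ)
      = (∑ k, c k * (D.M k.succ l.succ : ℝ)) * (c l * D.symmetrizer l.succ) := by
        rw [Finset.sum_mul]
        exact Finset.sum_congr rfl fun k _ => by ring
    _ = 0 := by rw [hz, zero_mul]

theorem level_apply (x : Coweight n) : D.level x = ∑ i, (D.a i : ℝ) * simpleRoot i x := by
  simp [level, LinearMap.sum_apply]

theorem finrank_levelZero : Module.finrank ℝ D.levelZero = n := by
  have hne : D.level ≠ 0 := fun h => by
    have h1 : D.level (Pi.single 0 1) = D.a 0 := by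
      simp [level_apply, simpleRoot, Pi.single_apply]
    rw [h] at h1
    exact (D.a_pos_real 0).ne h1
  have h := Module.Dual.finrank_ker_add_one_of_ne_zero hne
  rw [Module.finrank_fin_fun] at h
  exact Nat.succ_injective h

/-- The simple coroots `α₁^∨, …, αₙ^∨` form a basis of the level `0` hyperplane. -/
noncomputable def corootBasis : Module.Basis (Fin n) ℝ D.levelZero :=
  haveI : FiniteDimensional ℝ D.levelZero := inferInstance
  Module.Basis.mk D.linearIndependent_simpleCorootZero
    (D.linearIndependent_simpleCorootZero.span_eq_top_of_card_eq_finrank'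
      (by rw [Fintype.card_fin, D.finrank_levelZero])).ge

theorem corootBasis_apply (k : Fin n) : D.corootBasis k = D.simpleCorootZero k.succ := by
  simp [corootBasis]

/-- The finite coroot system of the level `0` hyperplane: its simple roots are the coroots
`α₁^∨, …, αₙ^∨`. -/
noncomputable def simpleSystem : SimpleSystem (Fin n) D.levelZero where
  basis := D.corootBasis
  form := Matrix.toBilin D.corootBasis
    (Matrix.of fun k l => (D.M k.succ l.succ : ℝ) * D.symmetrizer l.succ)
  symm x y := by
    rw [Matrix.toBilin_apply, Matrix.toBilin_apply, Finset.sum_comm]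
    refine Finset.sum_congr rfl fun k _ => Finset.sum_congr rfl fun l _ => ?_
    simp only [Matrix.of_apply]
    rw [D.M_mul_symmetrizer]
    ring
  pos x hx := by
    rw [Matrix.toBilin_apply]
    have h := D.quadratic_succ_pos (c := fun k => D.corootBasis.repr x k) fun h =>
      hx (D.corootBasis.ext_elem fun k => by simpa using congrFun h k)
    refine h.trans_eq (Finset.sum_congr rfl fun k _ => Finset.sum_congr rfl fun l _ => ?_)
    simp only [Matrix.of_apply]
    ring
  cartan k l := D.M k.succ l.succ
  two_mul_form k l := by
    simp only [Matrix.toBilin_apply, Module.Basis.repr_self, Matrix.of_apply, Finsupp.single_apply,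
      ite_mul, one_mul, zero_mul, mul_ite, mul_one, mul_zero, Finset.sum_ite_eq, Finset.mem_univ,
      if_true, D.diag, Int.cast_ofNat]
    ring
  cartan_nonpos k l h := D.offDiag_nonpos _ _ fun h' => h (Fin.succ_injective _ h')

theorem simpleSystem_basis (k : Fin n) : D.simpleSystem.basis k = D.simpleCorootZero k.succ :=
  D.corootBasis_apply k

theorem simpleSystem_form_basis (x : D.levelZero) (l : Fin n) :
    D.simpleSystem.form x (D.simpleSystem.basis l) =
      simpleRoot l.succ (x : Coweight n) * D.symmetrizer l.succ := by
  conv_rhs => rw [← D.simpleSystem.basis.sum_repr x]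
  rw [SimpleSystem.form_eq_sum, Submodule.coe_sum, map_sum, Finset.sum_mul]
  refine Finset.sum_congr rfl fun k _ => ?_
  have h : D.simpleSystem.form (D.simpleSystem.basis k) (D.simpleSystem.basis l) =
      D.M k.succ l.succ * D.symmetrizer l.succ := by
    have h1 := D.simpleSystem.two_mul_form k l
    have h2 : D.simpleSystem.form (D.simpleSystem.basis l) (D.simpleSystem.basis l) =
        2 * D.symmetrizer l.succ := by
      simp only [simpleSystem, Matrix.toBilin_apply, Module.Basis.repr_self, Matrix.of_apply,
        Finsupp.single_apply, ite_mul, one_mul, zero_mul, mul_ite, mul_one, mul_zero,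
        Finset.sum_ite_eq, Finset.mem_univ, if_true, D.diag, Int.cast_ofNat]
    rw [h2] at h1
    have h3 : D.simpleSystem.cartan k l = D.M k.succ l.succ := rfl
    rw [h3] at h1
    linarith
  rw [h, simpleSystem_basis]
  simp [simpleRoot, simpleCorootZero, simpleCoroot, mul_assoc]

theorem sBar_apply (i : Fin (n + 1)) (x : D.levelZero) :
    (D.sBar i).1 x = x - simpleRoot i (x : Coweight n) • D.simpleCorootZero i :=
  Subtype.ext (Module.reflection_apply x.1 (D.simpleRoot_simpleCoroot i))

theorem simpleRoot_sBar (i : Fin (n + 1)) (x : D.levelZero) :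
    simpleRoot i ((D.sBar i).1 x : Coweight n) = -simpleRoot i (x : Coweight n) := by
  rw [sBar_apply, Submodule.coe_sub, Submodule.coe_smul, map_sub, map_smul]
  have : simpleRoot i (D.simpleCorootZero i : Coweight n) = 2 := D.simpleRoot_simpleCoroot i
  rw [this, smul_eq_mul]
  ring

theorem sBar_mul_self (i : Fin (n + 1)) : D.sBar i * D.sBar i = 1 := by
  refine Subtype.ext (LinearEquiv.ext fun x => Subtype.ext ?_)
  exact Module.involutive_reflection (D.simpleRoot_simpleCoroot i) x.1

theorem sBar_inv (i : Fin (n + 1)) : (D.sBar i)⁻¹ = D.sBar i :=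
  inv_eq_of_mul_eq_one_left (D.sBar_mul_self i)

theorem simpleSystem_refl (k : Fin n) : D.simpleSystem.refl k = (D.sBar k.succ).1 := by
  refine LinearEquiv.ext fun x => ?_
  have h1 : simpleRoot k.succ (D.simpleCorootZero k.succ : Coweight n) = 2 :=
    D.simpleRoot_simpleCoroot k.succ
  have h2 := (D.symmetrizer_pos k.succ).ne'
  rw [SimpleSystem.refl_apply, sBar_apply, simpleSystem_form_basis, simpleSystem_form_basis,
    simpleSystem_basis, h1]
  congr 2
  field_simp

theorem simpleSystem_chamber : D.simpleSystem.chamber = D.fundamentalChamber := by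
  ext x
  refine forall_congr' fun k => ?_
  rw [simpleSystem_form_basis]
  exact mul_pos_iff_of_pos_right (D.symmetrizer_pos k.succ)

theorem exists_word (hD : D.AppropriatelyLabelled) (w : D.finiteWeylGroup) :
    ∃ l, w.1 = D.simpleSystem.word l := by
  refine D.simpleSystem.exists_word_of_mem_closure ?_
  have h : w.1 ∈ (⊤ : Subgroup D.finiteWeylGroup).map D.finiteWeylGroup.subtype :=
    ⟨w, Subgroup.mem_top w, rfl⟩
  rw [← hD, MonoidHom.map_closure, ← Set.range_comp] at h
  have : D.simpleSystem.refl = D.finiteWeylGroup.subtype ∘ fun k : Fin n => D.sBar k.succ :=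
    funext D.simpleSystem_refl
  rwa [this]

theorem exists_eq_word (l : List (Fin n)) : ∃ w : D.finiteWeylGroup, w.1 = D.simpleSystem.word l := by
  induction l with
  | nil => exact ⟨1, rfl⟩
  | cons i l ih =>
    obtain ⟨w, hw⟩ := ih
    exact ⟨D.sBar i.succ * w, by
      rw [SimpleSystem.word_cons, ← hw, simpleSystem_refl, Subgroup.coe_mul]⟩

theorem finite_finiteWeylGroup (hD : D.AppropriatelyLabelled) : Finite D.finiteWeylGroup := by
  have := D.simpleSystem.finite_closure
  refine Finite.of_injective
    (β := Subgroup.closure (Set.range D.simpleSystem.refl)) (fun w => ⟨w.1, ?_⟩)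
    fun u v h => Subtype.ext (Subtype.mk.inj h)
  obtain ⟨l, hl⟩ := D.exists_word hD w
  rw [hl, SimpleSystem.word]
  refine Subgroup.list_prod_mem _ fun x hx => ?_
  obtain ⟨i, -, rfl⟩ := List.mem_map.1 hx
  exact Subgroup.subset_closure ⟨i, rfl⟩

theorem positiveRoots_eq (hD : D.AppropriatelyLabelled) :
    D.simpleSystem.positiveRoots = D.positiveFiniteCoroots := by
  ext β
  refine and_congr ⟨?_, ?_⟩ ⟨fun h => ⟨_, h, ?_⟩, ?_⟩
  · rintro ⟨l, j, rfl⟩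
    obtain ⟨w, hw⟩ := D.exists_eq_word l
    exact ⟨w, j, by rw [hw, simpleSystem_basis]⟩
  · rintro ⟨w, j, rfl⟩
    obtain ⟨l, hl⟩ := D.exists_word hD w
    exact ⟨l, j, by rw [hl, simpleSystem_basis]⟩
  · simp_rw [← simpleSystem_basis]
    exact (D.simpleSystem.basis.sum_repr β).symm
  · rintro ⟨c, hc, rfl⟩ k
    simp_rw [← simpleSystem_basis]
    rw [Module.Basis.repr_sum_self]
    exact hc k

theorem rhoCheck_mem (hD : D.AppropriatelyLabelled) : D.rhoCheck ∈ D.fundamentalChamber := by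
  intro k
  have h := D.simpleSystem.finsum_positiveRoots_mem_chamber
  rw [simpleSystem_chamber, positiveRoots_eq D hD] at h
  rw [rhoCheck, Submodule.coe_smul, map_smul]
  exact mul_pos (by norm_num) (h k)

/-! ### Chambers and their images under the projections -/

theorem eq_one_of_mem (hD : D.AppropriatelyLabelled) {w : D.finiteWeylGroup} {x : D.levelZero}
    (hx : x ∈ D.fundamentalChamber) (hwx : w.1 x ∈ D.fundamentalChamber) : w = 1 := by
  obtain ⟨l, hl⟩ := D.exists_word hD w
  rw [← simpleSystem_chamber] at hx hwx
  rw [hl] at hwx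
  exact Subtype.ext (hl.trans (D.simpleSystem.word_eq_one_of_mem_chamber hx hwx))

theorem apply_inv_apply (w : D.finiteWeylGroup) (x : D.levelZero) : w.1 ((w⁻¹).1 x) = x :=
  w.1.apply_symm_apply x

/-- No chamber meets the hyperplane of a simple root `α i`, including `α 0`: a point of both would
be fixed by `cl (s i)`. -/
theorem simpleRoot_ne_zero (hD : D.AppropriatelyLabelled) (w : D.finiteWeylGroup)
    {y : D.levelZero} (hy : y ∈ D.fundamentalChamber) (i : Fin (n + 1)) :
    simpleRoot i ((w⁻¹).1 y : Coweight n) ≠ 0 := by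
  intro h
  have hfix : (w * D.sBar i * w⁻¹).1 y = y := by
    change w.1 ((D.sBar i).1 ((w⁻¹).1 y)) = y
    rw [sBar_apply, h, zero_smul, sub_zero, apply_inv_apply]
  have h1 := D.eq_one_of_mem hD (w := w * D.sBar i * w⁻¹) hy (by rwa [hfix])
  have h2 : D.sBar i = 1 := conj_eq_one_iff.1 h1
  have h3 := D.simpleRoot_sBar i (D.simpleCorootZero i)
  rw [h2] at h3
  have h4 : simpleRoot i (D.simpleCorootZero i : Coweight n) = 2 := D.simpleRoot_simpleCoroot i
  change simpleRoot i (D.simpleCorootZero i : Coweight n) = _ at h3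
  rw [h4] at h3
  norm_num at h3

/-- Every simple root `α i`, including `α 0`, has constant sign on each chamber. -/
theorem simpleRoot_pos_iff (hD : D.AppropriatelyLabelled) (w : D.finiteWeylGroup)
    {x y : D.levelZero} (hx : x ∈ D.fundamentalChamber) (hy : y ∈ D.fundamentalChamber)
    (i : Fin (n + 1)) :
    0 < simpleRoot i ((w⁻¹).1 x : Coweight n) ↔ 0 < simpleRoot i ((w⁻¹).1 y : Coweight n) := by
  suffices key : ∀ {x y : D.levelZero}, x ∈ D.fundamentalChamber → y ∈ D.fundamentalChamber →
      0 < simpleRoot i ((w⁻¹).1 x : Coweight n) →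
      0 < simpleRoot i ((w⁻¹).1 y : Coweight n) from ⟨key hx hy, key hy hx⟩
  intro x y hx hy h
  by_contra hneg
  have hlt := lt_of_le_of_ne (not_lt.1 hneg) (D.simpleRoot_ne_zero hD w hy i)
  set p := simpleRoot i ((w⁻¹).1 x : Coweight n) with hp
  set q := simpleRoot i ((w⁻¹).1 y : Coweight n) with hq
  -- This positive combination of `x` and `y` is the point where the form vanishes.
  have hz : (-q) • x + p • y ∈ D.fundamentalChamber := fun k => by
    rw [Submodule.coe_add, Submodule.coe_smul, Submodule.coe_smul, map_add, map_smul, map_smul]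
    exact add_pos (mul_pos (neg_pos.2 hlt) (hx k)) (mul_pos h (hy k))
  refine D.simpleRoot_ne_zero hD w hz i ?_
  rw [map_add, map_smul, map_smul, Submodule.coe_add, Submodule.coe_smul, Submodule.coe_smul,
    map_add, map_smul, map_smul, ← hp, ← hq, smul_eq_mul, smul_eq_mul]
  ring

theorem bijOn_chamberOf (hD : D.AppropriatelyLabelled) :
    Set.BijOn D.chamberOf Set.univ D.chambers := by
  refine ⟨fun w _ => ⟨w⁻¹, rfl⟩, fun u _ v _ h => ?_, ?_⟩
  · have h1 : (u⁻¹).1 D.rhoCheck ∈ D.chamberOf v := by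
      rw [← h]; exact ⟨_, D.rhoCheck_mem hD, rfl⟩
    obtain ⟨y, hy, hyu⟩ := h1
    have h2 : (v * u⁻¹).1 D.rhoCheck = y := by
      change v.1 ((u⁻¹).1 D.rhoCheck) = y
      rw [← hyu, apply_inv_apply]
    have h3 := D.eq_one_of_mem hD (D.rhoCheck_mem hD) (by rwa [h2] : (v * u⁻¹).1 D.rhoCheck ∈ _)
    exact (mul_inv_eq_one.1 h3).symm
  · rintro _ ⟨w, rfl⟩
    exact ⟨w⁻¹, Set.mem_univ _, by simp [chamberOf]⟩

theorem piZero_of_pos {i : Fin (n + 1)} {x : D.levelZero} (h : 0 < simpleRoot i (x : Coweight n)) :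
    D.piZero i x = (D.sBar i).1 x :=
  Subtype.ext (if_pos h)

theorem piZero_of_not_pos {i : Fin (n + 1)} {x : D.levelZero}
    (h : ¬ 0 < simpleRoot i (x : Coweight n)) : D.piZero i x = x :=
  Subtype.ext (if_neg h)

theorem piGroup_of_pos {i : Fin (n + 1)} {w : D.finiteWeylGroup}
    (h : 0 < simpleRoot i ((w⁻¹).1 D.rhoCheck : Coweight n)) : D.piGroup w i = w * D.sBar i :=
  if_pos h

theorem piGroup_of_not_pos {i : Fin (n + 1)} {w : D.finiteWeylGroup}
    (h : ¬ 0 < simpleRoot i ((w⁻¹).1 D.rhoCheck : Coweight n)) : D.piGroup w i = w :=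
  if_neg h

theorem piChamber_chamberOf (hD : D.AppropriatelyLabelled) (w : D.finiteWeylGroup)
    (i : Fin (n + 1)) : D.piChamber (D.chamberOf w) i = D.chamberOf (D.piGroup w i) := by
  have hsign := fun (x : D.levelZero) (hx : x ∈ D.fundamentalChamber) =>
    D.simpleRoot_pos_iff hD w (D.rhoCheck_mem hD) hx i
  rw [piChamber, chamberOf, Set.image_image]
  by_cases h : 0 < simpleRoot i ((w⁻¹).1 D.rhoCheck : Coweight n)
  · rw [D.piGroup_of_pos h, chamberOf, mul_inv_rev, sBar_inv]
    exact Set.image_congr fun x hx => D.piZero_of_pos ((hsign x hx).1 h)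
  · rw [D.piGroup_of_not_pos h, chamberOf]
    exact Set.image_congr fun x hx => D.piZero_of_not_pos fun h' => h ((hsign x hx).2 h')

theorem foldl_piChamber (hD : D.AppropriatelyLabelled) (l : List (Fin (n + 1)))
    (w : D.finiteWeylGroup) :
    l.foldl D.piChamber (D.chamberOf w) = D.chamberOf (l.foldl D.piGroup w) := by
  induction l generalizing w with
  | nil => rfl
  | cons i l ih => rw [List.foldl_cons, List.foldl_cons, D.piChamber_chamberOf hD, ih]

/-! ### Transitivity -/

/-- A set of group elements that is closed under the operators `π i` is closed under right
multiplication by the `cl (s i)`. View `a i * ⟨w⁻¹ ρ^∨, α i⟩` as the flow from `w` to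
`w * cl (s i)`. It is antisymmetric, and since `w⁻¹ ρ^∨` has level `0`, the flows out of each `w` add
up to `0`; hence so do the flows across the boundary of the set. A positive flow follows some `π i`,
so that none leaves the set. Therefore all flows across the boundary are `0`, whereas no flow
`a i * ⟨w⁻¹ ρ^∨, α i⟩` is `0`: the boundary is empty. -/
theorem mul_sBar_mem_of_piGroup_mem (hD : D.AppropriatelyLabelled) {R : Finset D.finiteWeylGroup}
    (hR : ∀ w ∈ R, ∀ i, D.piGroup w i ∈ R) {w : D.finiteWeylGroup} (hw : w ∈ R)
    (i : Fin (n + 1)) : w * D.sBar i ∈ R := by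
  classical
  set f : Fin (n + 1) → D.finiteWeylGroup → ℝ :=
    fun i w => simpleRoot i ((w⁻¹).1 D.rhoCheck : Coweight n) with hf
  have hflip : ∀ i w, f i (w * D.sBar i) = -f i w := fun i w => by
    simp only [hf, mul_inv_rev, sBar_inv]
    exact D.simpleRoot_sBar i ((w⁻¹).1 D.rhoCheck)
  have hboundary : ∀ i, ∀ w ∈ R.filter fun w => ¬ w * D.sBar i ∈ R, f i w ≤ 0 := by
    intro i w hw
    obtain ⟨hw, hws⟩ := Finset.mem_filter.1 hw
    by_contra h
    refine hws ?_
    rw [← D.piGroup_of_pos (not_le.1 h)]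
    exact hR w hw i
  have hsplit : ∀ i, ∑ w ∈ R, f i w = ∑ w ∈ R with ¬ w * D.sBar i ∈ R, f i w := by
    intro i
    rw [← Finset.sum_filter_add_sum_filter_not R (fun w => w * D.sBar i ∈ R)]
    refine add_eq_right.2 (Finset.sum_involution (fun w _ => w * D.sBar i) ?_ ?_ ?_ ?_)
    · intro w _; rw [hflip, add_neg_cancel]
    · intro w _ hne heq
      have := hflip i w
      rw [heq] at this
      exact hne (by linarith)
    · intro w hw
      obtain ⟨hw, hws⟩ := Finset.mem_filter.1 hw
      exact Finset.mem_filter.2 ⟨hws, by rwa [mul_assoc, sBar_mul_self, mul_one]⟩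
    · intro w _; simp only [mul_assoc, sBar_mul_self, mul_one]
  have hnonpos : ∀ i, ∑ w ∈ R, f i w ≤ 0 := fun i => by
    rw [hsplit]; exact Finset.sum_nonpos (hboundary i)
  have htotal : ∑ i, (D.a i : ℝ) * ∑ w ∈ R, f i w = 0 := by
    simp_rw [Finset.mul_sum]
    rw [Finset.sum_comm]
    refine Finset.sum_eq_zero fun w _ => ?_
    rw [← level_apply]
    exact D.mem_levelZero.1 ((w⁻¹).1 D.rhoCheck).2
  have hzero : ∑ w ∈ R, f i w = 0 := by
    have := (Finset.sum_eq_zero_iff_of_nonpos fun i _ =>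
      mul_nonpos_of_nonneg_of_nonpos (D.a_pos_real i).le (hnonpos i)).1 htotal i (Finset.mem_univ i)
    exact (mul_eq_zero.1 this).resolve_left (D.a_pos_real i).ne'
  by_contra hws
  rw [hsplit] at hzero
  exact D.simpleRoot_ne_zero hD w (D.rhoCheck_mem hD) i
    ((Finset.sum_eq_zero_iff_of_nonpos (hboundary i)).1 hzero w
      (Finset.mem_filter.2 ⟨hw, hws⟩))

theorem exists_foldl_piGroup_eq (hD : D.AppropriatelyLabelled) (w w' : D.finiteWeylGroup) :
    ∃ l : List (Fin (n + 1)), l.foldl D.piGroup w = w' := by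
  have := D.finite_finiteWeylGroup hD
  set R : Finset D.finiteWeylGroup :=
    (Set.toFinite {v | ∃ l : List (Fin (n + 1)), l.foldl D.piGroup w = v}).toFinset with hRdef
  have hmem : ∀ v, v ∈ R ↔ ∃ l : List (Fin (n + 1)), l.foldl D.piGroup w = v := fun v => by
    simp [hRdef]
  have hR : ∀ v ∈ R, ∀ i, D.piGroup v i ∈ R := by
    intro v hv i
    obtain ⟨l, rfl⟩ := (hmem v).1 hv
    exact (hmem _).2 ⟨l ++ [i], by simp⟩
  have hinv : ∀ g : D.finiteWeylGroup, ∀ v, v ∈ R ↔ v * g ∈ R := by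
    intro g
    have hg : g ∈ Subgroup.closure (Set.range fun k : Fin n => D.sBar k.succ) := by
      rw [hD]; exact Subgroup.mem_top g
    induction hg using Subgroup.closure_induction with
    | mem g hg =>
      obtain ⟨k, rfl⟩ := hg
      refine fun v => ⟨fun h => D.mul_sBar_mem_of_piGroup_mem hD hR h _, fun h => ?_⟩
      have := D.mul_sBar_mem_of_piGroup_mem hD hR h k.succ
      rwa [mul_assoc, sBar_mul_self, mul_one] at this
    | one => intro v; rw [mul_one]
    | mul g h _ _ hg hh => intro v; rw [hg, hh, mul_assoc]
    | inv g _ hg => intro v; rw [hg (v * g⁻¹), inv_mul_cancel_right]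
  refine (hmem w').1 ?_
  rw [← mul_inv_cancel_left w w']
  exact (hinv _ w).1 ((hmem w).2 ⟨[], rfl⟩)

end AffineCartanMatrix
end AffineWeyl

theorem mainTheorem2 {n : ℕ} (D : AffineWeyl.AffineCartanMatrix n)
    (hD : D.AppropriatelyLabelled) :
    -- transitivity on the finite Weyl group
    (∀ w w' : D.finiteWeylGroup, ∃ l : List (Fin (n + 1)), l.foldl D.piGroup w = w') ∧
    -- the elements correspond to the chambers, compatibly with the actions
    (Set.BijOn D.chamberOf Set.univ D.chambers ∧
      ∀ (w : D.finiteWeylGroup) (i : Fin (n + 1)),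
        D.piChamber (D.chamberOf w) i = D.chamberOf (D.piGroup w i)) ∧
    -- transitivity on the chambers
    (∀ E ∈ D.chambers, ∀ E' ∈ D.chambers, ∃ l : List (Fin (n + 1)),
      l.foldl D.piChamber E = E') := by
  refine ⟨D.exists_foldl_piGroup_eq hD, ⟨D.bijOn_chamberOf hD, D.piChamber_chamberOf hD⟩, ?_⟩
  intro E hE E' hE'
  obtain ⟨w, -, rfl⟩ := (D.bijOn_chamberOf hD).surjOn hE
  obtain ⟨w', -, rfl⟩ := (D.bijOn_chamberOf hD).surjOn hE'
  obtain ⟨l, rfl⟩ := D.exists_foldl_piGroup_eq hD w w'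
  exact ⟨l, D.foldl_piChamber hD l w⟩
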